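/- A twisted link diagram is an oriented link diagram in the plane whose crossings are real (positive or negative) or virtual (encircled), possibly with bars on its edges; a virtual link diagram is a twisted link diagram without bars. Two twisted link diagrams are equivalent if they are related by a finite sequence of planar isotopies and extended Reidemeister moves: the classical moves R1, R2, R3; the virtual moves V1, V2, V3 (the analogues of R1, R2, R3 with virtual crossings only) and V4 (a strand with two consecutive virtual crossings slides across a real crossing); and the twisted moves T1 (a bar slides along its strand across a virtual crossing), T2 (two consecutive bars on an edge cancel) and T3 (a real crossing with a bar on each of its four legs is replaced by a real crossing of the same sign placed between two virtual crossings, so that the upper and the lower strand are exchanged). A twisted link is an equivalence class of twisted link diagrams, and a diagram represents a virtual link if it is equivalent to a virtual link diagram. For $m \geq 1$ let the non-orientable virtual $m$-foil $F_m$ be the following twisted link diagram: on two parallel strands with the same direction put $m$ consecutive positive real crossings (the 2-braid $\sigma_1^m$), then one bar on each of the two strands, then one virtual crossing, and close up the ends as in the closure of a 2-braid. (For $m=2$ it is Bourgoin's twofoil.) Then: (1) For $m > m' \geq 1$, $F_m$ and $F_{m'}$ represent distinct twisted links. (2) For every $m \geq 1$, $F_m$ does not represent a virtual link. -/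

import Mathlib

namespace TwistedLink

/-- The vertical direction in which an oriented strand crosses a horizontal line. -/
inductive Dir
  | up
  | down
  deriving DecidableEq

/-- The opposite direction. -/
def Dir.rev : Dir → Dir
  | .up => .down
  | .down => .up

/-- The three appearances of a crossing in the plane. `over`: the strand joining bottom left to
top right passes over; `under`: that strand passes under; `virt`: a virtual (encircled) crossing.
When both strands point upwards, `over` is a positive and `under` is a negative crossing. -/
inductive CrossingKind
  | over
  | under
  | virt
  deriving DecidableEq

/-- The appearance of a crossing after a quarter turn (equivalently, after exchanging the
information which of the two strands is the upper one). -/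
def CrossingKind.swap : CrossingKind → CrossingKind
  | .over => .under
  | .under => .over
  | .virt => .virt

/-- The elementary pieces of an oriented diagram in general position with respect to the height
function. A `cup` is a local minimum, a `cap` is a local maximum; their label is the direction of
the left leg. The labels of a crossing are the directions, at the bottom, of the left and of the
right strand. A `bar` is a bar on a strand of the given direction. -/
inductive Piece
  | cup (s : Dir)
  | cap (s : Dir)
  | cross (k : CrossingKind) (s t : Dir)
  | bar (s : Dir)
  deriving DecidableEq

/-- The directions of the strands at the bottom of a piece, from left to right. -/
def Piece.dom : Piece → List Dir
  | .cup _ => []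
  | .cap s => [s, s.rev]
  | .cross _ s t => [s, t]
  | .bar s => [s]

/-- The directions of the strands at the top of a piece, from left to right. -/
def Piece.cod : Piece → List Dir
  | .cup s => [s, s.rev]
  | .cap _ => []
  | .cross _ s t => [t, s]
  | .bar s => [s]

/-- A horizontal slice of a diagram: one elementary piece, with vertical strands to the left
and to the right of it. -/
structure Slice where
  left : List Dir
  piece : Piece
  right : List Dir

def Slice.dom (σ : Slice) : List Dir := σ.left ++ σ.piece.dom ++ σ.right

def Slice.cod (σ : Slice) : List Dir := σ.left ++ σ.piece.cod ++ σ.right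

/-- The slices of `w`, stacked from bottom to top, fit together to an oriented tangle diagram
from the strands `a` at the bottom to the strands `b` at the top. -/
def Fits : List Dir → List Slice → List Dir → Prop
  | a, [], b => a = b
  | a, σ :: w, b => a = σ.dom ∧ Fits σ.cod w b

/-- A twisted link diagram: an oriented closed planar diagram with real crossings, virtual
crossings and bars, in general position with respect to the height function (all crossings, bars,
maxima and minima at different heights), cut into its slices from bottom to top. -/
def Diagram : Type := {w : List Slice // Fits [] w []}

/-- Vertical strands `l` and `r` are added to the left and to the right of a tangle diagram. -/
def pad (l r : List Dir) (w : List Slice) : List Slice :=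
  w.map fun σ => ⟨l ++ σ.left, σ.piece, σ.right ++ r⟩

/-- The local moves. Every move is allowed for all orientations of the strands. The first seven
generate the isotopies of the plane; the others are the extended Reidemeister moves. -/
inductive Move : List Slice → List Slice → Prop
  /-- Pieces that lie side by side can exchange their heights. -/
  | interchange (g h : Piece) (m : List Dir) :
      Move [⟨[], g, m ++ h.dom⟩, ⟨g.cod ++ m, h, []⟩]
        [⟨g.dom ++ m, h, []⟩, ⟨[], g, m ++ h.cod⟩]
  /-- A strand that goes up, down and up again, towards the left, is straightened. -/
  | zigzagLeft (s : Dir) :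
      Move [⟨[s], .cup s.rev, []⟩, ⟨[], .cap s, [s]⟩] []
  /-- A strand that goes up, down and up again, towards the right, is straightened. -/
  | zigzagRight (s : Dir) :
      Move [⟨[], .cup s, [s]⟩, ⟨[s], .cap s.rev, []⟩] []
  /-- A strand slides across a maximum of another strand. -/
  | crossCap (k : CrossingKind) (s t : Dir) :
      Move [⟨[s], .cross k t s.rev, []⟩, ⟨[], .cap s, [t]⟩]
        [⟨[], .cross k.swap s t, [s.rev]⟩, ⟨[t], .cap s, []⟩]
  /-- A strand slides across a minimum of another strand. -/
  | crossCup (k : CrossingKind) (s t : Dir) :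
      Move [⟨[], .cup s, [t]⟩, ⟨[s], .cross k s.rev t, []⟩]
        [⟨[t], .cup s, []⟩, ⟨[], .cross k.swap t s, [s.rev]⟩]
  /-- A bar slides across a maximum. -/
  | barCap (s : Dir) :
      Move [⟨[], .bar s, [s.rev]⟩, ⟨[], .cap s, []⟩]
        [⟨[s], .bar s.rev, []⟩, ⟨[], .cap s, []⟩]
  /-- A bar slides across a minimum. -/
  | barCup (s : Dir) :
      Move [⟨[], .cup s, []⟩, ⟨[], .bar s, [s.rev]⟩]
        [⟨[], .cup s, []⟩, ⟨[s], .bar s.rev, []⟩]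
  /-- R1 (for a real crossing) and V1 (for a virtual crossing), with the loop on the right. -/
  | kinkRight (k : CrossingKind) (s : Dir) :
      Move [⟨[s], .cup s, []⟩, ⟨[], .cross k s s, [s.rev]⟩, ⟨[s], .cap s, []⟩] []
  /-- R1 (for a real crossing) and V1 (for a virtual crossing), with the loop on the left. -/
  | kinkLeft (k : CrossingKind) (s : Dir) :
      Move [⟨[], .cup s.rev, [s]⟩, ⟨[s.rev], .cross k s s, []⟩, ⟨[], .cap s.rev, [s]⟩] []
  /-- R2 (for real crossings) and V2 (for virtual crossings). -/
  | bigon (k : CrossingKind) (s t : Dir) :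
      Move [⟨[], .cross k s t, []⟩, ⟨[], .cross k.swap t s, []⟩] []
  /-- R3. -/
  | r3 (s t u : Dir) :
      Move
        [⟨[], .cross .over s t, [u]⟩, ⟨[t], .cross .over s u, []⟩, ⟨[], .cross .over t u, [s]⟩]
        [⟨[s], .cross .over t u, []⟩, ⟨[], .cross .over s u, [t]⟩, ⟨[u], .cross .over s t, []⟩]
  /-- V4 (for `k` real) and V3 (for `k` virtual): a strand with two consecutive virtual crossings
  slides across a crossing. -/
  | detour (k : CrossingKind) (s t u : Dir) :
      Move
        [⟨[], .cross k s t, [u]⟩, ⟨[t], .cross .virt s u, []⟩, ⟨[], .cross .virt t u, [s]⟩]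
        [⟨[s], .cross .virt t u, []⟩, ⟨[], .cross .virt s u, [t]⟩, ⟨[u], .cross k s t, []⟩]
  /-- T1: a bar slides across a virtual crossing. -/
  | t1 (s t : Dir) :
      Move [⟨[], .bar s, [t]⟩, ⟨[], .cross .virt s t, []⟩]
        [⟨[], .cross .virt s t, []⟩, ⟨[t], .bar s, []⟩]
  /-- T2: two consecutive bars cancel. -/
  | t2 (s : Dir) :
      Move [⟨[], .bar s, []⟩, ⟨[], .bar s, []⟩] []
  /-- T3: a crossing with a bar on each of its four legs is replaced by the crossing between two
  virtual crossings. (For `k` virtual it is a consequence of T1, T2 and V2.) -/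
  | t3 (k : CrossingKind) (s t : Dir) :
      Move
        [⟨[], .bar s, [t]⟩, ⟨[s], .bar t, []⟩, ⟨[], .cross k s t, []⟩,
          ⟨[], .bar t, [s]⟩, ⟨[t], .bar s, []⟩]
        [⟨[], .cross .virt s t, []⟩, ⟨[], .cross k t s, []⟩, ⟨[], .cross .virt s t, []⟩]

/-- `E` arises from `D` by one local move, performed somewhere in the diagram. -/
def Diagram.Step (D E : Diagram) : Prop :=
  ∃ (p q : List Slice) (l r : List Dir) (u v : List Slice), Move u v ∧
    D.1 = p ++ pad l r u ++ q ∧ E.1 = p ++ pad l r v ++ q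

/-- Two diagrams are equivalent if they are related by a finite sequence of local moves and their
inverses. -/
instance Diagram.equivalence : Setoid Diagram := Relation.EqvGen.setoid Diagram.Step

/-- A twisted link is an equivalence class of twisted link diagrams. -/
def Link : Type := Quotient Diagram.equivalence

/-- The twisted link represented by a diagram. -/
def Diagram.link (D : Diagram) : Link := Quotient.mk Diagram.equivalence D

/-- A virtual link diagram is a diagram without bars. -/
def Diagram.IsVirtual (D : Diagram) : Prop := ∀ σ ∈ D.1, ∀ s : Dir, σ.piece ≠ .bar s

/-- The diagram represents a virtual link: it is equivalent to a virtual link diagram. -/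
def Diagram.RepresentsVirtualLink (D : Diagram) : Prop :=
  ∃ D' : Diagram, D'.IsVirtual ∧ D.link = D'.link

/-- The slices of the non-orientable virtual `m`-foil, from bottom to top: on two parallel strands
directed upwards, `m` positive crossings, a bar on each strand and a virtual crossing; the ends
are closed up by two parallel arcs on the right, as in the closure of a 2-braid. -/
def foilWord (m : ℕ) : List Slice :=
  [⟨[], .cup .up, []⟩, ⟨[.up], .cup .up, [.down]⟩] ++
  List.replicate m ⟨[], .cross .over .up .up, [.down, .down]⟩ ++
  [⟨[], .bar .up, [.up, .down, .down]⟩, ⟨[.up], .bar .up, [.down, .down]⟩,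
    ⟨[], .cross .virt .up .up, [.down, .down]⟩,
    ⟨[.up], .cap .up, [.down]⟩, ⟨[], .cap .up, []⟩]

theorem foilWord_fits (m : ℕ) : Fits [] (foilWord m) [] := by
  refine ⟨rfl, rfl, ?_⟩
  induction m with
  | zero => exact ⟨rfl, rfl, rfl, rfl, rfl, rfl⟩
  | succ n ih => exact ⟨rfl, ih⟩

/-- The non-orientable virtual `m`-foil `F_m`. -/
def foil (m : ℕ) : Diagram := ⟨foilWord m, foilWord_fits m⟩

end TwistedLink

namespace TwistedLink

/-! Two-colour the strands so that the colour is constant along a strand, except that it changes at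
every bar when `e = true`. Weigh a colouring by the sum of the signs of the real crossings whose two
strands have different colours, a linking number. Colourings extend uniquely and with equal weight
across each local move (`Move.colored`), so the set of weights is an invariant of the twisted link
for each `e` (`Diagram.weights_eq_of_link_eq`). For `F_m` (`mem_weights_foil`) the sets are: for `m`
even, `{0}` if `e = false` and `{m}` if `e = true`; for `m` odd, `{0, m}` if `e = false` and the
empty set if `e = true`. Hence even `m` is detected by `e = true` and odd `m` by `e = false`. A
diagram without bars has the constant colouring, so `0` is a weight for both `e`; for `F_m` with `m
≥ 1` and `e = true` it is not. -/

/-- The sign of a direction. -/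
def Dir.sign : Dir → ℤ
  | .up => 1
  | .down => -1

/-- The sign of a crossing of two upward strands; virtual crossings have sign zero. -/
def CrossingKind.sign : CrossingKind → ℤ
  | .over => 1
  | .under => -1
  | .virt => 0

@[simp] theorem Dir.sign_rev (s : Dir) : s.rev.sign = -s.sign := by
  cases s <;> rfl

@[simp] theorem CrossingKind.sign_swap (k : CrossingKind) : k.swap.sign = -k.sign := by
  cases k <;> rfl

@[simp] theorem CrossingKind.sign_virt : CrossingKind.virt.sign = 0 := rfl

/-- The piece `p` admits a colouring of its strands by two colours that restricts to `x` at the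
bottom and to `y` at the top. The colour changes at a bar if `e = true`. The weight `n` of the
colouring is the sum of the signs of the real crossings between strands of different colours. -/
def Piece.Colored (e : Bool) : Piece → List Bool → List Bool → ℤ → Prop
  | .cup _, x, y, n => x = [] ∧ (∃ c, y = [c, c]) ∧ n = 0
  | .cap _, x, y, n => (∃ c, x = [c, c]) ∧ y = [] ∧ n = 0
  | .cross k s t, x, y, n => ∃ a b, x = [a, b] ∧ y = [b, a] ∧
      n = if a = b then 0 else k.sign * s.sign * t.sign
  | .bar _, x, y, n => ∃ a, x = [a] ∧ y = [xor a e] ∧ n = 0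

/-- Colourings of a slice; see `Piece.Colored`. -/
def Slice.Colored (e : Bool) (σ : Slice) (x y : List Bool) (n : ℤ) : Prop :=
  ∃ l u v r, l.length = σ.left.length ∧ r.length = σ.right.length ∧
    x = l ++ (u ++ r) ∧ y = l ++ (v ++ r) ∧ σ.piece.Colored e u v n

/-- Colourings of a tangle diagram; see `Piece.Colored`. -/
def WordColored (e : Bool) : List Slice → List Bool → List Bool → ℤ → Prop
  | [], x, y, n => x = y ∧ n = 0
  | σ :: w, x, y, n => ∃ z i j, σ.Colored e x z i ∧ WordColored e w z y j ∧ n = i + j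

/-! ### Colourings of stacked and padded words -/

variable {e : Bool}

theorem Piece.Colored.length {p : Piece} {x y : List Bool} {n : ℤ} (h : p.Colored e x y n) :
    x.length = p.dom.length ∧ y.length = p.cod.length := by
  cases p
  · obtain ⟨rfl, ⟨c, rfl⟩, -⟩ := h; exact ⟨rfl, rfl⟩
  · obtain ⟨⟨c, rfl⟩, rfl, -⟩ := h; exact ⟨rfl, rfl⟩
  · obtain ⟨a, b, rfl, rfl, -⟩ := h; exact ⟨rfl, rfl⟩
  · obtain ⟨a, rfl, rfl, -⟩ := h; exact ⟨rfl, rfl⟩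

theorem Slice.Colored.length {σ : Slice} {x y : List Bool} {n : ℤ} (h : σ.Colored e x y n) :
    x.length = σ.dom.length ∧ y.length = σ.cod.length := by
  obtain ⟨l, u, v, r, hl, hr, rfl, rfl, hp⟩ := h
  have := hp.length
  simp only [Slice.dom, Slice.cod, List.length_append]
  omega

theorem slice_colored_append {σ : Slice} {l u r : List Bool} (hl : l.length = σ.left.length)
    (hu : u.length = σ.piece.dom.length) {y : List Bool} {n : ℤ}
    (hr : r.length = σ.right.length) :
    σ.Colored e (l ++ (u ++ r)) y n ↔ ∃ v, y = l ++ (v ++ r) ∧ σ.piece.Colored e u v n := by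
  constructor
  · rintro ⟨l', u', v, r', hl', hr', hx, rfl, hp⟩
    obtain ⟨h1, hx⟩ := List.append_inj hx (by omega)
    obtain ⟨h2, h3⟩ := List.append_inj hx (by have := hp.length; omega)
    subst h1 h2 h3
    exact ⟨v, rfl, hp⟩
  · rintro ⟨v, rfl, hp⟩
    exact ⟨l, u, v, r, hl, hr, rfl, rfl, hp⟩

theorem wordColored_singleton {σ : Slice} {x y : List Bool} {n : ℤ} :
    WordColored e [σ] x y n ↔ σ.Colored e x y n := by
  simp [WordColored]

theorem wordColored_append {w w' : List Slice} {x y : List Bool} {n : ℤ} :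
    WordColored e (w ++ w') x y n ↔
      ∃ z i j, WordColored e w x z i ∧ WordColored e w' z y j ∧ n = i + j := by
  induction w generalizing x n with
  | nil => simp [WordColored]
  | cons σ w ih =>
    simp only [List.cons_append, WordColored, ih]
    constructor
    · rintro ⟨z, i, _, hσ, ⟨z', j, k, hw, hw', rfl⟩, rfl⟩
      exact ⟨z', i + j, k, ⟨z, i, j, hσ, hw, rfl⟩, hw', by ring⟩
    · rintro ⟨z', _, k, ⟨z, i, j, hσ, hw, rfl⟩, hw', rfl⟩
      exact ⟨z, i, j + k, hσ, ⟨z', j, k, hw, hw', rfl⟩, by ring⟩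

theorem fits_append {w w' : List Slice} {a b : List Dir} :
    Fits a (w ++ w') b ↔ ∃ c, Fits a w c ∧ Fits c w' b := by
  induction w generalizing a with
  | nil => simp [Fits]
  | cons σ w ih => simp only [List.cons_append, Fits, ih, and_assoc, exists_and_left]

theorem WordColored.length {w : List Slice} {a b : List Dir} (hw : Fits a w b)
    {x y : List Bool} {n : ℤ} (h : WordColored e w x y n) (hx : x.length = a.length) :
    y.length = b.length := by
  induction w generalizing a x n with
  | nil => obtain ⟨rfl, -⟩ := h; rw [hx, show a = b from hw]
  | cons σ w ih =>
    obtain ⟨z, i, j, hσ, hz, -⟩ := h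
    exact ih hw.2 hz hσ.length.2

/-- Added vertical strands keep their colours, so a local move can be studied without its
surroundings. The colours of the padding are recovered from the lengths alone. -/
theorem slice_colored_pad {l r : List Dir} {xl xr : List Bool} (hl : xl.length = l.length)
    (hr : xr.length = r.length) {σ : Slice} {x z : List Bool} {n : ℤ} :
    Slice.Colored e ⟨l ++ σ.left, σ.piece, σ.right ++ r⟩ (xl ++ (x ++ xr)) z n ↔
      ∃ y, z = xl ++ (y ++ xr) ∧ σ.Colored e x y n := by
  constructor
  · rintro ⟨l', u, v, r', hl', hr', hx, rfl, hp⟩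
    simp only [List.length_append] at hl' hr'
    obtain ⟨p, q, rfl, hp1⟩ : ∃ p q, l' = p ++ q ∧ p.length = l.length :=
      ⟨l'.take l.length, l'.drop l.length, by simp, by simp; omega⟩
    obtain ⟨p', q', rfl, hp2⟩ : ∃ p q, r' = p ++ q ∧ p.length = σ.right.length :=
      ⟨r'.take σ.right.length, r'.drop σ.right.length, by simp, by simp; omega⟩
    simp only [List.length_append] at hl' hr'
    rw [List.append_assoc] at hx
    obtain ⟨h1, hx⟩ := List.append_inj hx (by omega)
    rw [show q ++ (u ++ (p' ++ q')) = (q ++ (u ++ p')) ++ q' by simp] at hx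
    obtain ⟨h2, h3⟩ := List.append_inj' hx (by omega)
    subst h1 h2 h3
    exact ⟨q ++ (v ++ p'), by simp, q, u, v, p', by omega, by omega, by simp, rfl, hp⟩
  · rintro ⟨_, rfl, l', u, v, r', hl', hr', rfl, rfl, hp⟩
    exact ⟨xl ++ l', u, v, r' ++ xr, by simp [*], by simp [*], by simp, by simp, hp⟩

theorem wordColored_pad {l r : List Dir} {xl xr : List Bool} (hl : xl.length = l.length)
    (hr : xr.length = r.length) {w : List Slice} {x z : List Bool} {n : ℤ} :
    WordColored e (pad l r w) (xl ++ (x ++ xr)) z n ↔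
      ∃ y, z = xl ++ (y ++ xr) ∧ WordColored e w x y n := by
  induction w generalizing x n with
  | nil => simp [pad, WordColored, eq_comm]
  | cons σ w ih =>
    rw [pad, List.map_cons, ← pad]
    simp only [WordColored, slice_colored_pad hl hr]
    constructor
    · rintro ⟨_, i, j, ⟨y, rfl, hσ⟩, hw, rfl⟩
      obtain ⟨y', rfl, hw'⟩ := ih.1 hw
      exact ⟨y', rfl, y, i, j, hσ, hw', rfl⟩
    · rintro ⟨y', rfl, y, i, j, hσ, hw, rfl⟩
      exact ⟨_, i, j, ⟨y, rfl, hσ⟩, ih.2 ⟨y', rfl, hw⟩, rfl⟩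

theorem interchange_colored (g h : Piece) (m : List Dir) {x y : List Bool} {n : ℤ}
    (hx : x.length = (g.dom ++ m ++ h.dom).length) :
    WordColored e [⟨[], g, m ++ h.dom⟩, ⟨g.cod ++ m, h, []⟩] x y n ↔
      WordColored e [⟨g.dom ++ m, h, []⟩, ⟨[], g, m ++ h.cod⟩] x y n := by
  obtain ⟨u, c, v, rfl, hu, hc, hv⟩ : ∃ u c v : List Bool, x = u ++ (c ++ v) ∧
      u.length = g.dom.length ∧ c.length = m.length ∧ v.length = h.dom.length := by
    simp only [List.length_append] at hx
    exact ⟨x.take g.dom.length, (x.drop g.dom.length).take m.length,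
      (x.drop g.dom.length).drop m.length, by simp, by simp; omega, by simp; omega,
      by simp; omega⟩
  -- Either order of the two pieces amounts to independent colourings of `g` and `h` with the
  -- strands between them unchanged; this is the common normal form.
  have key : WordColored e [⟨[], g, m ++ h.dom⟩, ⟨g.cod ++ m, h, []⟩] (u ++ (c ++ v)) y n ↔
      ∃ u' v' i j, y = u' ++ (c ++ v') ∧ g.Colored e u u' i ∧ h.Colored e v v' j ∧
        n = i + j := by
    constructor
    · rintro ⟨z, i, j, hz, hy, rfl⟩
      obtain ⟨u', rfl, hg⟩ := (slice_colored_append (l := []) (u := u) (r := c ++ v) rfl hu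
        (by simp [hc, hv])).1 hz
      have := hg.length
      rw [wordColored_singleton, show [] ++ (u' ++ (c ++ v)) = (u' ++ c) ++ (v ++ []) by simp,
        slice_colored_append (by simp [*]) hv rfl] at hy
      obtain ⟨v', rfl, hh⟩ := hy
      exact ⟨u', v', i, j, by simp, hg, hh, rfl⟩
    · rintro ⟨u', v', i, j, rfl, hg, hh, rfl⟩
      have := hg.length
      exact ⟨u' ++ (c ++ v), i, j, ⟨[], u, u', c ++ v, rfl, by simp [*], rfl, rfl, hg⟩,
        wordColored_singleton.2 ⟨u' ++ c, v, v', [], by simp [*], rfl, by simp, by simp, hh⟩, rfl⟩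
  rw [key]
  constructor
  · rintro ⟨u', v', i, j, rfl, hg, hh, rfl⟩
    have := hh.length
    exact ⟨u ++ (c ++ v'), j, i, ⟨u ++ c, v, v', [], by simp [*], rfl, by simp, by simp, hh⟩,
      wordColored_singleton.2 ⟨[], u, u', c ++ v', rfl, by simp [*], rfl, rfl, hg⟩, add_comm _ _⟩
  · rintro ⟨z, j, i, hz, hy, rfl⟩
    rw [show u ++ (c ++ v) = (u ++ c) ++ (v ++ []) by simp,
      slice_colored_append (by simp [*]) hv rfl] at hz
    obtain ⟨v', rfl, hh⟩ := hz
    have := hh.length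
    rw [wordColored_singleton, show (u ++ c) ++ (v' ++ []) = [] ++ (u ++ (c ++ v')) by simp,
      slice_colored_append rfl hu (by simp [*])] at hy
    obtain ⟨u', rfl, hg⟩ := hy
    exact ⟨u', v', i, j, rfl, hg, hh, add_comm _ _⟩

/-! ### Evaluation rules for single slices -/

@[simp] theorem slice_colored_cons {a : Bool} {s : Dir} {L R : List Dir} {p : Piece}
    {x z : List Bool} {n : ℤ} :
    Slice.Colored e ⟨s :: L, p, R⟩ (a :: x) z n ↔
      ∃ y, z = a :: y ∧ Slice.Colored e ⟨L, p, R⟩ x y n := by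
  simpa using slice_colored_pad (e := e) (l := [s]) (r := []) (xl := [a]) (xr := []) rfl rfl
    (σ := ⟨L, p, R⟩) (x := x) (z := z) (n := n)

@[simp] theorem slice_colored_cup {R : List Dir} {s : Dir} {x y : List Bool} {n : ℤ} :
    Slice.Colored e ⟨[], .cup s, R⟩ x y n ↔
      x.length = R.length ∧ (∃ c, y = c :: c :: x) ∧ n = 0 := by
  constructor
  · rintro ⟨a, _, _, b, ha, hb, rfl, rfl, rfl, ⟨c, rfl⟩, rfl⟩
    obtain rfl := List.length_eq_zero_iff.1 ha
    exact ⟨hb, ⟨c, rfl⟩, rfl⟩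
  · rintro ⟨hx, ⟨c, rfl⟩, rfl⟩
    exact ⟨[], _, _, x, rfl, hx, rfl, rfl, rfl, ⟨c, rfl⟩, rfl⟩

@[simp] theorem slice_colored_cap {R : List Dir} {s : Dir} {c d : Bool} {x y : List Bool} {n : ℤ} :
    Slice.Colored e ⟨[], .cap s, R⟩ (c :: d :: x) y n ↔
      x.length = R.length ∧ c = d ∧ y = x ∧ n = 0 := by
  constructor
  · rintro ⟨a, _, _, b, ha, hb, hx, rfl, ⟨c', rfl⟩, rfl, rfl⟩
    obtain rfl := List.length_eq_zero_iff.1 ha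
    obtain ⟨rfl, rfl, rfl⟩ : c = c' ∧ d = c' ∧ x = b := by simpa using hx
    exact ⟨hb, rfl, rfl, rfl⟩
  · rintro ⟨hx, rfl, rfl, rfl⟩
    exact ⟨[], _, _, y, rfl, hx, rfl, rfl, ⟨c, rfl⟩, rfl, rfl⟩

@[simp] theorem slice_colored_cross {R : List Dir} {k : CrossingKind} {s t : Dir} {c d : Bool}
    {x y : List Bool} {n : ℤ} :
    Slice.Colored e ⟨[], .cross k s t, R⟩ (c :: d :: x) y n ↔
      x.length = R.length ∧ y = d :: c :: x ∧
        n = if c = d then 0 else k.sign * s.sign * t.sign := by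
  constructor
  · rintro ⟨a, _, _, b, ha, hb, hx, rfl, c', d', rfl, rfl, rfl⟩
    obtain rfl := List.length_eq_zero_iff.1 ha
    obtain ⟨rfl, rfl, rfl⟩ : c = c' ∧ d = d' ∧ x = b := by simpa using hx
    exact ⟨hb, rfl, rfl⟩
  · rintro ⟨hx, rfl, rfl⟩
    exact ⟨[], _, _, x, rfl, hx, rfl, rfl, c, d, rfl, rfl, rfl⟩

@[simp] theorem slice_colored_bar {R : List Dir} {s : Dir} {c : Bool} {x y : List Bool} {n : ℤ} :
    Slice.Colored e ⟨[], .bar s, R⟩ (c :: x) y n ↔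
      x.length = R.length ∧ y = xor c e :: x ∧ n = 0 := by
  constructor
  · rintro ⟨a, _, _, b, ha, hb, hx, rfl, c', rfl, rfl, rfl⟩
    obtain rfl := List.length_eq_zero_iff.1 ha
    obtain ⟨rfl, rfl⟩ : c = c' ∧ x = b := by simpa using hx
    exact ⟨hb, rfl, rfl⟩
  · rintro ⟨hx, rfl, rfl⟩
    exact ⟨[], _, _, x, rfl, hx, rfl, rfl, c, rfl, rfl, rfl⟩

/-! ### Invariance of the weights under local moves -/

/-- The strands at the bottom of a nonempty word of slices. -/
def wordDom : List Slice → List Dir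
  | [] => []
  | σ :: _ => σ.dom

/-- Local moves preserve the weights of the colourings with given boundary colours. -/
theorem Move.colored {u v : List Slice} (h : Move u v) {x y : List Bool} {n : ℤ}
    (hx : x.length = (wordDom u).length) : WordColored e u x y n ↔ WordColored e v x y n := by
  cases h with
  | interchange g h m =>
    exact interchange_colored g h m (by simpa [wordDom, Slice.dom, add_assoc] using hx)
  | zigzagLeft s =>
    obtain ⟨a, rfl⟩ := List.length_eq_one_iff.1 hx
    cases a <;> simp [WordColored, eq_comm, or_comm]
  | zigzagRight s =>
    obtain ⟨a, rfl⟩ := List.length_eq_one_iff.1 hx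
    cases a <;> simp [WordColored, eq_comm]
  -- Sliding over an extremum swaps the crossing and reverses one strand; the two changes of sign
  -- cancel.
  | crossCap k s t =>
    obtain ⟨a, b, c, rfl⟩ := List.length_eq_three.1 hx
    cases a <;> cases b <;> cases c <;> simp [WordColored, mul_right_comm]
  | crossCup k s t =>
    obtain ⟨a, rfl⟩ := List.length_eq_one_iff.1 hx
    cases a <;> simp [WordColored, mul_right_comm]
  | barCap s =>
    obtain ⟨a, b, rfl⟩ := List.length_eq_two.1 hx
    cases a <;> cases b <;> cases e <;> simp [WordColored]
  | barCup s =>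
    obtain rfl := List.length_eq_zero_iff.1 hx
    cases e <;> simp [WordColored, or_comm]
  -- The closing arc forces equal colours at the crossing, so it contributes zero.
  | kinkRight k s =>
    obtain ⟨a, rfl⟩ := List.length_eq_one_iff.1 hx
    cases a <;> simp [WordColored, eq_comm]
  | kinkLeft k s =>
    obtain ⟨a, rfl⟩ := List.length_eq_one_iff.1 hx
    cases a <;> simp [WordColored, eq_comm, or_comm]
  | bigon k s t =>
    obtain ⟨a, b, rfl⟩ := List.length_eq_two.1 hx
    cases a <;> cases b <;> simp [WordColored, mul_right_comm, eq_comm]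
  -- The same pairs of strands cross on both sides, only in another order.
  | r3 s t u =>
    obtain ⟨a, b, c, rfl⟩ := List.length_eq_three.1 hx
    cases a <;> cases b <;> cases c <;> simp [WordColored, add_comm]
  | detour k s t u =>
    obtain ⟨a, b, c, rfl⟩ := List.length_eq_three.1 hx
    cases a <;> cases b <;> cases c <;> simp [WordColored]
  | t1 s t =>
    obtain ⟨a, b, rfl⟩ := List.length_eq_two.1 hx
    cases a <;> cases b <;> cases e <;> simp [WordColored]
  | t2 s =>
    obtain ⟨a, rfl⟩ := List.length_eq_one_iff.1 hx
    cases a <;> simp [WordColored, eq_comm]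
  -- The bars change both colours before the crossing and restore them after it, so whether the
  -- colours differ is unaffected; the sign is symmetric in the two strands.
  | t3 k s t =>
    obtain ⟨a, b, rfl⟩ := List.length_eq_two.1 hx
    simp [WordColored]
    cases a <;> cases b <;> simp [mul_right_comm]

/-- The weights of the colourings of a diagram. -/
def Diagram.weights (e : Bool) (D : Diagram) : Set ℤ := {n | WordColored e D.1 [] [] n}

/-- The left side of every move is a nonempty word, so its first slice determines the strands at the
bottom. -/
theorem Move.dom_eq {u v : List Slice} (h : Move u v) {l r a b : List Dir}
    (hf : Fits a (pad l r u) b) : a = l ++ (wordDom u ++ r) := by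
  cases h <;> rw [hf.1] <;> simp [wordDom, Slice.dom]

theorem Diagram.Step.weights_eq {D E : Diagram} (h : D.Step E) : D.weights e = E.weights e := by
  obtain ⟨p, q, l, r, u, v, hm, hD, hE⟩ := h
  have hf := D.2
  rw [hD, List.append_assoc, fits_append] at hf
  obtain ⟨a, hp, hf⟩ := hf
  rw [fits_append] at hf
  obtain ⟨b, hf, -⟩ := hf
  obtain rfl := hm.dom_eq hf
  ext n
  simp only [Diagram.weights, Set.mem_ofPred_eq, hD, hE, List.append_assoc, wordColored_append]
  -- The two diagrams differ only in the middle factor. That the colours `z` below it have the right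
  -- length follows from `Fits`, and this is what permits splitting off the padding.
  refine exists_congr fun z => exists_congr fun i => exists_congr fun j =>
    and_congr_right fun hz => and_congr_left fun _ => ?_
  have hlen := hz.length hp rfl
  simp only [List.length_append] at hlen
  obtain ⟨xl, x, xr, rfl, hl, hx, hr⟩ : ∃ xl x xr : List Bool, z = xl ++ (x ++ xr) ∧
      xl.length = l.length ∧ x.length = (wordDom u).length ∧ xr.length = r.length :=
    ⟨z.take l.length, (z.drop l.length).take (wordDom u).length,
      (z.drop l.length).drop (wordDom u).length, by simp, by simp; omega, by simp; omega,
      by simp; omega⟩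
  simp only [wordColored_pad hl hr, hm.colored hx]

theorem Diagram.weights_eq_of_link_eq {D E : Diagram} (h : D.link = E.link) (e : Bool) :
    D.weights e = E.weights e := by
  have h' : Relation.EqvGen Diagram.Step D E := Quotient.exact h
  clear h
  induction h' with
  | rel _ _ h => exact h.weights_eq
  | refl => rfl
  | symm _ _ _ ih => exact ih.symm
  | trans _ _ _ _ _ ih ih' => exact ih.trans ih'

/-! ### The weights of virtual links and of the foils -/

/-- A virtual link diagram can be coloured with a single colour. -/
theorem wordColored_replicate {w : List Slice} {a b : List Dir} (hf : Fits a w b)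
    (hw : ∀ σ ∈ w, ∀ s : Dir, σ.piece ≠ .bar s) :
    WordColored e w (List.replicate a.length false) (List.replicate b.length false) 0 := by
  induction w generalizing a with
  | nil => exact ⟨by rw [show a = b from hf], rfl⟩
  | cons σ w ih =>
    obtain ⟨rfl, hf⟩ := hf
    refine ⟨_, 0, 0, ?_, ih hf fun τ hτ => hw τ (List.mem_cons_of_mem _ hτ), rfl⟩
    refine ⟨List.replicate σ.left.length false, List.replicate σ.piece.dom.length false,
      List.replicate σ.piece.cod.length false, List.replicate σ.right.length false,
      by simp, by simp, by simp [Slice.dom], by simp [Slice.cod], ?_⟩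
    have := hw σ (by simp)
    obtain ⟨L, p, R⟩ := σ
    cases p with
    | bar s => exact absurd rfl (this s)
    | cup s => exact ⟨rfl, ⟨false, rfl⟩, rfl⟩
    | cap s => exact ⟨⟨false, rfl⟩, rfl, rfl⟩
    | cross k s t => exact ⟨false, false, rfl, rfl, rfl⟩

theorem Diagram.IsVirtual.zero_mem_weights {D : Diagram} (h : D.IsVirtual) :
    0 ∈ D.weights e :=
  wordColored_replicate D.2 h

/-- Each crossing exchanges the two colours and contributes `1` exactly when they differ, so the
parity of `m` decides the final order. -/
theorem twist_colored (m : ℕ) (a b c d : Bool) {z : List Bool} {n : ℤ} :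
    WordColored e (List.replicate m ⟨[], .cross .over .up .up, [.down, .down]⟩) [a, b, c, d] z n ↔
      z = (if Even m then [a, b, c, d] else [b, a, c, d]) ∧ n = if a = b then 0 else (m : ℤ) := by
  induction m generalizing a b n with
  | zero => simp [WordColored, eq_comm]
  | succ m ih =>
    rw [List.replicate_succ]
    by_cases hm : Even m <;> cases a <;> cases b <;> simp [WordColored, ih, hm, Nat.even_add_one, CrossingKind.sign, Dir.sign, add_comm]

/-- After the virtual crossing the nested maxima join the first strand to the third and the second
to the fourth, once both colours have passed a bar. -/
theorem foil_closing_colored {a b c d : Bool} {n : ℤ} :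
    WordColored e [⟨[], .bar .up, [.up, .down, .down]⟩, ⟨[.up], .bar .up, [.down, .down]⟩,
      ⟨[], .cross .virt .up .up, [.down, .down]⟩,
      ⟨[.up], .cap .up, [.down]⟩, ⟨[], .cap .up, []⟩] [a, b, c, d] [] n ↔
      xor a e = c ∧ xor b e = d ∧ n = 0 := by
  simp [WordColored, and_assoc]

theorem foil_opening_colored {x : List Bool} {n : ℤ} :
    WordColored e [⟨[], .cup .up, []⟩, ⟨[.up], .cup .up, [.down]⟩] [] x n ↔
      ∃ a b, x = [a, b, b, a] ∧ n = 0 := by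
  simp only [WordColored, slice_colored_cup]
  constructor
  · rintro ⟨_, i, j, ⟨-, ⟨a, rfl⟩, rfl⟩, ⟨_, k, l, hz, ⟨rfl, rfl⟩, rfl⟩, rfl⟩
    obtain ⟨_, rfl, hc⟩ := slice_colored_cons.1 hz
    obtain ⟨-, ⟨b, rfl⟩, rfl⟩ := slice_colored_cup.1 hc
    exact ⟨a, b, rfl, rfl⟩
  · rintro ⟨a, b, rfl, rfl⟩
    exact ⟨_, 0, 0, ⟨rfl, ⟨a, rfl⟩, rfl⟩, ⟨_, 0, 0,
      slice_colored_cons.2 ⟨_, rfl, slice_colored_cup.2 ⟨rfl, ⟨b, rfl⟩, rfl⟩⟩,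
      ⟨rfl, rfl⟩, rfl⟩, rfl⟩

/-- The opening arcs give the colours `a, b, b, a`. For even `m` the closure then requires each
strand to turn into the other one across its bar; for odd `m` each colour must survive its own bar,
which excludes `e = true`. -/
theorem mem_weights_foil {m : ℕ} {n : ℤ} :
    n ∈ (foil m).weights e ↔ ∃ a b : Bool, (n = if a = b then 0 else (m : ℤ)) ∧
      if Even m then b = xor a e else e = false := by
  have hword : n ∈ (foil m).weights e ↔ WordColored e (foilWord m) [] [] n := Iff.rfl
  rw [hword, foilWord, List.append_assoc, wordColored_append]
  constructor
  · rintro ⟨_, i, j, hx, h, rfl⟩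
    obtain ⟨a, b, rfl, rfl⟩ := foil_opening_colored.1 hx
    obtain ⟨_, k, l, hz, h', rfl⟩ := wordColored_append.1 h
    obtain ⟨rfl, rfl⟩ := (twist_colored m a b b a).1 hz
    refine ⟨a, b, ?_⟩
    split_ifs at h' ⊢ <;> obtain ⟨h1, h2, rfl⟩ := foil_closing_colored.1 h' <;>
      clear hx hz h h' hword <;> cases a <;> cases b <;> cases e <;> simp_all
  · rintro ⟨a, b, rfl, h⟩
    refine ⟨_, 0, _, foil_opening_colored.2 ⟨a, b, rfl, rfl⟩,
      wordColored_append.2 ⟨_, _, 0, (twist_colored m a b b a).2 ⟨rfl, rfl⟩, ?_, rfl⟩, by simp⟩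
    split_ifs at h ⊢ <;> exact foil_closing_colored.2 (by simp [h])

theorem foil_link_ne {m m' : ℕ} (h : m' < m) (h' : 1 ≤ m') : (foil m).link ≠ (foil m').link := by
  intro hl
  have key (e : Bool) (n : ℤ) : n ∈ (foil m).weights e ↔ n ∈ (foil m').weights e := by
    rw [Diagram.weights_eq_of_link_eq hl]
  simp only [mem_weights_foil] at key
  by_cases hm : Even m
  -- Different colours give `F_m` the weight `m`, but every weight of `F_{m'}` is `0` or `m'`.
  · obtain ⟨a, b, h0, h1⟩ := (key true m).1 ⟨true, false, by simp, by simp [hm]⟩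
    split_ifs at h0 <;> omega
  · obtain ⟨a, b, h0, h1⟩ := (key false m).1 ⟨true, false, by simp, by simp [hm]⟩
    split_ifs at h0 <;> omega

theorem foil_not_representsVirtualLink {m : ℕ} (hm : 1 ≤ m) :
    ¬ (foil m).RepresentsVirtualLink := by
  rintro ⟨D, hD, hl⟩
  have h := hD.zero_mem_weights (e := true)
  rw [← Diagram.weights_eq_of_link_eq hl true, mem_weights_foil] at h
  obtain ⟨a, b, h0, h1⟩ := h
  by_cases hm' : Even m
  -- For `e = true` and `m` even the two colours must differ, so the only weight is `m`, which is
  -- nonzero.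
  · cases a <;> cases b <;> simp [hm'] at h0 h1 <;> omega
  · simp [hm'] at h1

end TwistedLink

theorem theorem5 :
    (∀ m m' : ℕ, m > m' → m' ≥ 1 →
      (TwistedLink.foil m).link ≠ (TwistedLink.foil m').link) ∧
    (∀ m : ℕ, m ≥ 1 → ¬ (TwistedLink.foil m).RepresentsVirtualLink) :=
  ⟨fun _ _ h h' => TwistedLink.foil_link_ne h h',
    fun _ hm => TwistedLink.foil_not_representsVirtualLink hm⟩
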